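/- Let $0<T\le\infty$. A (classical, properly immersed) mean curvature flow of an $n$-manifold $X$ in $\mathbb R^3$ on $[0,T)$ is a map $F:X\times[0,T)\to\mathbb R^3$, $F_t=F(\cdot,t)$, which is smooth with each $F_t$ an immersion for $t\in(0,T)$, continuous on $X\times[0,T)$, whose normal velocity $(\partial_tF)^\perp$ equals the mean curvature vector of $F_t$ for $t\in(0,T)$, and for which $(x,t)\mapsto(F_t(x),t)$, $X\times[0,T)\to\mathbb R^3\times[0,T)$, is a proper map. Let $\Gamma_t=\gamma_t(C)$, $t\in[0,T)$, be a curve shortening flow in $\mathbb R^3$, i.e. such a flow $\gamma$ of a $1$-manifold $C$ (closed or non-compact curves, not necessarily embedded). Let $M_t=F_t(M)$, $t\in[0,T)$, be a convex $2$-dimensional mean curvature flow in $\mathbb R^3$, i.e. such a flow of a $2$-manifold $M$ for which every $F_t$ is injective and $M_t=\partial K_t$ for a closed convex set $K_t\subset\mathbb R^3$ with non-empty interior, where $K_t$ varies continuously in $t$ (that is, $\{(x,t): x\in \operatorname{int}K_t\}$ and $\{(x,t):x\notin K_t\}$ are open in $\mathbb R^3\times[0,T)$). The convexity need not be strict and $K_t$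 need not be bounded. Suppose that $\Gamma_0$ is disjoint from $M_0$ and lies outside of it, i.e. $\Gamma_0\cap K_0=\emptyset$, and that $\Gamma_t$ and $M_t$ can only intersect in a bounded region, i.e. $\bigcup_{t\in[0,T)}(\Gamma_t\cap M_t)$ is bounded. Then $\Gamma_t\cap M_t=\emptyset$ for all $t\in[0,T)$. -/

import Mathlib

open Set Topology Manifold
open scoped ContDiff

noncomputable section

/-- The time interval `[0, T)`, where `T = ⊤` stands for `T = ∞`. -/
def timeInterval (T : EReal) : Set ℝ := {t | 0 ≤ t ∧ (t : EReal) < T}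

/-- The open time interval `(0, T)`. -/
def openTimeInterval (T : EReal) : Set ℝ := {t | 0 < t ∧ (t : EReal) < T}

/-- The coordinate partial derivative `∂ᵢ f (z)`. -/
def partialDeriv {n : ℕ} (f : EuclideanSpace ℝ (Fin n) → EuclideanSpace ℝ (Fin 3)) (i : Fin n)
    (z : EuclideanSpace ℝ (Fin n)) : EuclideanSpace ℝ (Fin 3) :=
  fderiv ℝ f z (EuclideanSpace.single i 1)

/-- The first fundamental form `g i j = ⟨∂ᵢ f, ∂ⱼ f⟩` of a parametrized submanifold of `ℝ³`. -/
def firstFundamentalForm {n : ℕ} (f : EuclideanSpace ℝ (Fin n) → EuclideanSpace ℝ (Fin 3))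
    (z : EuclideanSpace ℝ (Fin n)) : Matrix (Fin n) (Fin n) ℝ :=
  Matrix.of fun i j => inner ℝ (partialDeriv f i z) (partialDeriv f j z)

/-- The component of `v` normal to the parametrized submanifold `f` at `f z`, that is, the
orthogonal projection of `v` to the orthogonal complement of the tangent space `range (df z)`. -/
def normalPart {n : ℕ} (f : EuclideanSpace ℝ (Fin n) → EuclideanSpace ℝ (Fin 3))
    (z : EuclideanSpace ℝ (Fin n)) (v : EuclideanSpace ℝ (Fin 3)) : EuclideanSpace ℝ (Fin 3) :=
  (LinearMap.range (fderiv ℝ f z : EuclideanSpace ℝ (Fin n) →ₗ[ℝ] EuclideanSpace ℝ (Fin 3)))ᗮ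
    |>.starProjection v

/-- The mean curvature vector `H = ∑ i j, gⁱʲ (∂ᵢ ∂ⱼ f)^⊥` (the trace of the vector valued second
fundamental form) of a parametrized submanifold of `ℝ³`. For `n = 1` this is
`(f'')^⊥ / |f'| ^ 2`, the curvature vector `κ N` of the curve `f`. -/
def meanCurvatureVector {n : ℕ} (f : EuclideanSpace ℝ (Fin n) → EuclideanSpace ℝ (Fin 3))
    (z : EuclideanSpace ℝ (Fin n)) : EuclideanSpace ℝ (Fin 3) :=
  ∑ i : Fin n, ∑ j : Fin n,
    (firstFundamentalForm f z)⁻¹ i j • normalPart f z (partialDeriv (partialDeriv f j) i z)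

/-- `F t : X → ℝ³`, `t ∈ [0, T)`, is a classical, properly immersed solution of mean curvature flow
of the `n`-dimensional manifold `X`: it is smooth and immersed for positive times, continuous up to
the initial time, its normal velocity is the mean curvature vector (the tangential velocity is
arbitrary, so that the notion does not depend on the parametrization), and the space-time map
`(x, t) ↦ (F t x, t)` into `ℝ³ × [0, T)` is proper. -/
structure IsMeanCurvatureFlow (n : ℕ) {X : Type*} [TopologicalSpace X]
    [ChartedSpace (EuclideanSpace ℝ (Fin n)) X] (T : EReal)
    (F : ℝ → X → EuclideanSpace ℝ (Fin 3)) : Prop where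
  /-- properness in space-time; this includes continuity on `X × [0, T)` -/
  proper : IsProperMap
    (fun p : X × timeInterval T => ((F p.2 p.1, p.2) : EuclideanSpace ℝ (Fin 3) × timeInterval T))
  smooth : ContMDiffOn ((𝓡 n).prod 𝓘(ℝ, ℝ)) 𝓘(ℝ, EuclideanSpace ℝ (Fin 3)) ∞
    (fun p : X × ℝ => F p.2 p.1) (univ ×ˢ openTimeInterval T)
  immersion : ∀ t ∈ openTimeInterval T, ∀ x : X,
    Function.Injective (mfderiv (𝓡 n) 𝓘(ℝ, EuclideanSpace ℝ (Fin 3)) (F t) x)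
  /-- in every coordinate chart, `(∂ₜ F)^⊥ = H` -/
  evolution : ∀ φ ∈ atlas (EuclideanSpace ℝ (Fin n)) X, ∀ z ∈ φ.target,
    ∀ t ∈ openTimeInterval T,
      normalPart (F t ∘ φ.symm) z (deriv (fun s => F s (φ.symm z)) t) =
        meanCurvatureVector (F t ∘ φ.symm) z

/-- A curve shortening flow in `ℝ³`: the normal velocity is the curvature vector `κ N`. The curves
may be closed or non-compact and need not be embedded. -/
def IsCurveShorteningFlow {C : Type*} [TopologicalSpace C]
    [ChartedSpace (EuclideanSpace ℝ (Fin 1)) C] (T : EReal)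
    (γ : ℝ → C → EuclideanSpace ℝ (Fin 3)) : Prop :=
  IsMeanCurvatureFlow 1 T γ

/-- A convex solution of 2-dimensional mean curvature flow in `ℝ³`: for every `t ∈ [0, T)` the
surface `F t` is embedded, with image the full boundary of a closed convex set `K t` with interior
points. Convexity is not strict; planes and cylinders are allowed, and `K t` may be unbounded.
The last two fields say that `K t` varies continuously with `t`. (They fix the side: a plane bounds
two convex sets, and `K t` must not jump from one of them to the other.) -/
structure IsConvexMeanCurvatureFlow {M : Type*} [TopologicalSpace M]
    [ChartedSpace (EuclideanSpace ℝ (Fin 2)) M] (T : EReal)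
    (F : ℝ → M → EuclideanSpace ℝ (Fin 3)) (K : ℝ → Set (EuclideanSpace ℝ (Fin 3))) : Prop where
  flow : IsMeanCurvatureFlow 2 T F
  injective : ∀ t ∈ timeInterval T, Function.Injective (F t)
  isClosed : ∀ t ∈ timeInterval T, IsClosed (K t)
  convex : ∀ t ∈ timeInterval T, Convex ℝ (K t)
  interior_nonempty : ∀ t ∈ timeInterval T, (interior (K t)).Nonempty
  range_eq : ∀ t ∈ timeInterval T, range (F t) = frontier (K t)
  isOpen_inside : IsOpen {p : EuclideanSpace ℝ (Fin 3) × timeInterval T | p.1 ∈ interior (K p.2)}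
  isOpen_outside : IsOpen {p : EuclideanSpace ℝ (Fin 3) × timeInterval T | p.1 ∉ K p.2}

end

/-! The proof is a maximum principle for the squared distance `D ^ 2` from a curve point to `K t`.
Suppose there is a contact, the first one at time `τ₀`. Until then the curve is outside `K t`. There
is no contact at time `0` or on the sphere of radius `R + 1`, so by properness `D ^ 2 ≥ ε > 0` there
up to time `τ₀`, whereas `D ^ 2` tends to `0` as a contact point is approached. Hence, for small `δ
> 0` and some `s < τ₀`, the minimum of `D ^ 2 + δ * t` over times up to `s` occurs at a positive
time and off the sphere.

At this minimum the nearest point of `K t` lies on the surface, and the vector `w` from it to the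
curve is normal to both. Displacing both points along the tangent `τ` of the curve gives `⟨w, γ''⟩ ≥
B(τ, τ)`, where `B` is the second fundamental form of the surface in direction `w`. Convexity gives
`B ≤ 0`, so dropping one principal direction can only increase the trace: `tr B ≤ B(τ, τ) / |τ| ^ 2`
(`inner_meanCurvatureVector_mul_le`). Thus `⟨w, H⟩ ≤ ⟨w, κN⟩`, and the squared distance of the two
points has time derivative at least `0`; minimality backward in time makes it at most `-δ`. This
contradiction is `nonpos_of_isMin_dist_sq`, transferred to `D` by
`IsCurveShorteningFlow.nonpos_of_isMin_infDist_sq`. -/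

/-! ### Second derivatives along lines -/

/-- A `C²` function has non-negative second derivative at a local minimum. -/
theorem IsLocalMin.second_deriv_nonneg {h h' : ℝ → ℝ} {a x : ℝ}
    (h1 : ∀ᶠ s in 𝓝 x, HasDerivAt h (h' s) s) (h2 : HasDerivAt h' a x)
    (hmin : IsLocalMin h x) : 0 ≤ a := by
  by_contra! ha
  have hd : deriv h =ᶠ[𝓝 x] h' := h1.mono fun s hs => hs.deriv
  have hdd : deriv (deriv h) x = a := by rw [hd.deriv_eq, h2.deriv]
  -- By the strict second derivative test `x` is also a local maximum, so `h` is constant near `x`,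
  -- which forces `a = 0`.
  have hmax : IsLocalMax h x := isLocalMax_of_deriv_deriv_neg (by rwa [hdd])
    hmin.deriv_eq_zero h1.self_of_nhds.continuousAt
  have hc : h =ᶠ[𝓝 x] fun _ => h x := by
    filter_upwards [hmin, hmax] with s hs hs' using le_antisymm hs' hs
  have h0 : deriv h =ᶠ[𝓝 x] fun _ => 0 := by
    have := hc.deriv
    simpa using this
  have : deriv (deriv h) x = 0 := by rw [h0.deriv_eq]; simp
  linarith

theorem fderiv_apply_eq_sum_partialDeriv {n : ℕ}
    (f : EuclideanSpace ℝ (Fin n) → EuclideanSpace ℝ (Fin 3)) (z v : EuclideanSpace ℝ (Fin n)) :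
    fderiv ℝ f z v = ∑ j, v j • partialDeriv f j z := by
  conv_lhs => rw [← (EuclideanSpace.basisFun (Fin n) ℝ).sum_repr v]
  simp [partialDeriv]

theorem ContDiffAt.eventually_hasDerivAt_line {n : ℕ}
    {f : EuclideanSpace ℝ (Fin n) → EuclideanSpace ℝ (Fin 3)} {z : EuclideanSpace ℝ (Fin n)}
    (hf : ContDiffAt ℝ 2 f z) (v : EuclideanSpace ℝ (Fin n)) :
    ∀ᶠ s in 𝓝 (0 : ℝ), HasDerivAt (fun s : ℝ => f (z + s • v)) (fderiv ℝ f (z + s • v) v) s := by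
  have h1 : ∀ᶠ y in 𝓝 z, DifferentiableAt ℝ f y :=
    (hf.eventually (by simp)).mono fun y hy => hy.differentiableAt (by simp)
  have hc : Filter.Tendsto (fun s : ℝ => z + s • v) (𝓝 0) (𝓝 z) := by
    have : Continuous fun s : ℝ => z + s • v := by fun_prop
    simpa using this.tendsto 0
  filter_upwards [hc.eventually h1] with s hs
  have hl : HasDerivAt (fun s : ℝ => z + s • v) v s := by
    simpa using ((hasDerivAt_id s).smul_const v).const_add z
  exact hs.hasFDerivAt.comp_hasDerivAt s hl

/-- The Hessian is kept as iterated partial derivatives, the form in which it enters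
`meanCurvatureVector`. -/
theorem ContDiffAt.hasDerivAt_fderiv_line {n : ℕ}
    {f : EuclideanSpace ℝ (Fin n) → EuclideanSpace ℝ (Fin 3)} {z : EuclideanSpace ℝ (Fin n)}
    (hf : ContDiffAt ℝ 2 f z) (v : EuclideanSpace ℝ (Fin n)) :
    HasDerivAt (fun s : ℝ => fderiv ℝ f (z + s • v) v)
      (∑ j, v j • ∑ i, v i • partialDeriv (partialDeriv f j) i z) 0 := by
  have hd : DifferentiableAt ℝ (fderiv ℝ f) z :=
    (hf.fderiv_right (m := 1) (by norm_num)).differentiableAt (by simp)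
  have hp (j : Fin n) : DifferentiableAt ℝ (partialDeriv f j) z :=
    hd.clm_apply (differentiableAt_const _)
  have hl : HasDerivAt (fun s : ℝ => z + s • v) v 0 := by
    simpa using ((hasDerivAt_id (0 : ℝ)).smul_const v).const_add z
  simp only [fderiv_apply_eq_sum_partialDeriv f]
  refine HasDerivAt.fun_sum fun j _ => HasDerivAt.const_smul (v j) ?_
  rw [← fderiv_apply_eq_sum_partialDeriv]
  have hj : HasFDerivAt (partialDeriv f j) (fderiv ℝ (partialDeriv f j) z) (z + (0 : ℝ) • v) := by
    simpa using (hp j).hasFDerivAt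
  exact hj.comp_hasDerivAt 0 hl

/-! ### Mean curvature paired with a normal vector -/

/-- The projection is self-adjoint and fixes the normal vector `w`. -/
theorem inner_normalPart_of_forall {n : ℕ}
    {f : EuclideanSpace ℝ (Fin n) → EuclideanSpace ℝ (Fin 3)} {z : EuclideanSpace ℝ (Fin n)}
    {w : EuclideanSpace ℝ (Fin 3)} (hw : ∀ v, inner ℝ w (fderiv ℝ f z v) = 0)
    (a : EuclideanSpace ℝ (Fin 3)) : inner ℝ w (normalPart f z a) = inner ℝ w a := by
  unfold normalPart
  rw [← Submodule.inner_starProjection_left_eq_right, Submodule.starProjection_eq_self_iff.2]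
  rw [Submodule.mem_orthogonal]
  rintro _ ⟨v, rfl⟩
  rw [real_inner_comm]
  exact hw v

theorem inner_meanCurvatureVector_of_forall {n : ℕ}
    {f : EuclideanSpace ℝ (Fin n) → EuclideanSpace ℝ (Fin 3)} {z : EuclideanSpace ℝ (Fin n)}
    {w : EuclideanSpace ℝ (Fin 3)} (hw : ∀ v, inner ℝ w (fderiv ℝ f z v) = 0) :
    inner ℝ w (meanCurvatureVector f z) = ∑ i, ∑ j, (firstFundamentalForm f z)⁻¹ i j *
      inner ℝ w (partialDeriv (partialDeriv f j) i z) := by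
  simp [meanCurvatureVector, inner_sum, inner_smul_right, inner_normalPart_of_forall hw]

/-- The trace of a negative semidefinite form with respect to the first fundamental form is at most
its value on any unit tangent vector. -/
theorem inner_meanCurvatureVector_mul_le
    {f : EuclideanSpace ℝ (Fin 2) → EuclideanSpace ℝ (Fin 3)} {z e : EuclideanSpace ℝ (Fin 2)}
    {w : EuclideanSpace ℝ (Fin 3)} (hw : ∀ v, inner ℝ w (fderiv ℝ f z v) = 0)
    (hi : Function.Injective (fderiv ℝ f z)) (he : e ≠ 0)
    (hB : ∀ v : EuclideanSpace ℝ (Fin 2),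
      inner ℝ w (∑ j, v j • ∑ i, v i • partialDeriv (partialDeriv f j) i z) ≤ 0) :
    inner ℝ w (meanCurvatureVector f z) * ‖fderiv ℝ f z e‖ ^ 2 ≤
      inner ℝ w (∑ j, e j • ∑ i, e i • partialDeriv (partialDeriv f j) i z) := by
  rw [inner_meanCurvatureVector_of_forall hw]
  set g := firstFundamentalForm f z with hg
  have hsymm : g 1 0 = g 0 1 :=
    real_inner_comm (partialDeriv f 0 z) (partialDeriv f 1 z)
  have hnorm (v : EuclideanSpace ℝ (Fin 2)) : ‖fderiv ℝ f z v‖ ^ 2 =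
      g 0 0 * v 0 ^ 2 + 2 * g 0 1 * v 0 * v 1 + g 1 1 * v 1 ^ 2 := by
    rw [← real_inner_self_eq_norm_sq, fderiv_apply_eq_sum_partialDeriv]
    simp only [Fin.sum_univ_two, inner_add_left, inner_add_right, inner_smul_left,
      inner_smul_right]
    have h00 : inner ℝ (partialDeriv f 0 z) (partialDeriv f 0 z) = g 0 0 := rfl
    have h01 : inner ℝ (partialDeriv f 0 z) (partialDeriv f 1 z) = g 0 1 := rfl
    have h10 : inner ℝ (partialDeriv f 1 z) (partialDeriv f 0 z) = g 1 0 := rfl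
    have h11 : inner ℝ (partialDeriv f 1 z) (partialDeriv f 1 z) = g 1 1 := rfl
    rw [h00, h01, h10, h11, hsymm]
    simp only [conj_trivial]
    ring
  have hpos (v : EuclideanSpace ℝ (Fin 2)) (hv : v ≠ 0) :
      0 < g 0 0 * v 0 ^ 2 + 2 * g 0 1 * v 0 * v 1 + g 1 1 * v 1 ^ 2 := by
    rw [← hnorm]
    have : fderiv ℝ f z v ≠ 0 := fun h => hv (hi (by simpa using h))
    positivity
  have hE := hpos e he
  set E := g 0 0 * e 0 ^ 2 + 2 * g 0 1 * e 0 * e 1 + g 1 1 * e 1 ^ 2 with hEdef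
  -- The quarter turn of `g e`: it is `g`-orthogonal to `e`, and `g(e', e') = det g * E`.
  set e' : EuclideanSpace ℝ (Fin 2) :=
    !₂[-(g 0 1 * e 0 + g 1 1 * e 1), g 0 0 * e 0 + g 0 1 * e 1] with he'
  have e'0 : e' 0 = -(g 0 1 * e 0 + g 1 1 * e 1) := by simp [he']
  have e'1 : e' 1 = g 0 0 * e 0 + g 0 1 * e 1 := by simp [he']
  have he'ne : e' ≠ 0 := by
    intro h
    have h0 : e' 0 = 0 := by rw [h]; rfl
    have h1 : e' 1 = 0 := by rw [h]; rfl
    rw [e'0] at h0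
    rw [e'1] at h1
    have : E = 0 := by rw [hEdef]; linear_combination e 0 * h1 - e 1 * h0
    exact hE.ne' this
  have hE' := hpos e' he'ne
  have hdet : 0 < g 0 0 * g 1 1 - g 0 1 ^ 2 := by
    rw [e'0, e'1] at hE'
    have : 0 < (g 0 0 * g 1 1 - g 0 1 ^ 2) * E := by rw [hEdef]; linarith
    exact pos_of_mul_pos_left this hE.le
  have hdet' : g.det = g 0 0 * g 1 1 - g 0 1 ^ 2 := by rw [Matrix.det_fin_two, hsymm]; ring
  have hB' := hB e'
  rw [hnorm, Matrix.inv_def, Matrix.adjugate_fin_two, hdet', Ring.inverse_eq_inv']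
  simp only [Fin.sum_univ_two, inner_add_right, inner_smul_right, Matrix.smul_apply, smul_eq_mul,
    e'0, e'1] at hB' ⊢
  simp only [Matrix.of_apply, Matrix.cons_val', Matrix.cons_val_zero, Matrix.cons_val_one,
    Matrix.cons_val_fin_one, hsymm]
  set B00 := inner ℝ w (partialDeriv (partialDeriv f 0) 0 z)
  set B01 := inner ℝ w (partialDeriv (partialDeriv f 1) 0 z)
  set B10 := inner ℝ w (partialDeriv (partialDeriv f 0) 1 z)
  set B11 := inner ℝ w (partialDeriv (partialDeriv f 1) 1 z)
  set D := g 0 0 * g 1 1 - g 0 1 ^ 2 with hD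
  rw [← sub_nonneg]
  refine (mul_nonneg_iff_of_pos_left hdet).1 ?_
  have hDD : D * D⁻¹ = 1 := mul_inv_cancel₀ hdet.ne'
  -- In the `g`-orthogonal frame `e, e'`, `tr B * E = B(e, e) + B(e', e') / D`; the left side of the
  -- inequality is therefore `-B(e', e')`.
  have key : D * (e 0 * (e 0 * B00 + e 1 * B10) + e 1 * (e 0 * B01 + e 1 * B11)) -
      (g 1 1 * B00 - g 0 1 * B01 - g 0 1 * B10 + g 0 0 * B11) * E ≥ 0 := by
    rw [hEdef, hD]; linarith
  rw [← hEdef]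
  linear_combination key + ((g 1 1 * B00 - g 0 1 * B01 - g 0 1 * B10 + g 0 0 * B11) * E) * hDD

theorem inner_meanCurvatureVector_curve
    {g : EuclideanSpace ℝ (Fin 1) → EuclideanSpace ℝ (Fin 3)} {u : EuclideanSpace ℝ (Fin 1)}
    {w : EuclideanSpace ℝ (Fin 3)} (hw : ∀ v, inner ℝ w (fderiv ℝ g u v) = 0)
    (hτ : partialDeriv g 0 u ≠ 0) :
    inner ℝ w (meanCurvatureVector g u) * ‖partialDeriv g 0 u‖ ^ 2 =
      inner ℝ w (partialDeriv (partialDeriv g 0) 0 u) := by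
  rw [inner_meanCurvatureVector_of_forall hw]
  have h : firstFundamentalForm g u 0 0 = ‖partialDeriv g 0 u‖ ^ 2 :=
    real_inner_self_eq_norm_sq (partialDeriv g 0 u)
  have hn : ‖partialDeriv g 0 u‖ ^ 2 ≠ 0 := by simpa using hτ
  rw [Matrix.inv_def, Matrix.det_fin_one, Ring.inverse_eq_inv', h]
  simp
  field_simp

/-- A vector orthogonal to the normal `w` of an immersed surface in `ℝ³` is tangent to it. -/
theorem exists_fderiv_eq_of_inner_eq_zero
    {L : EuclideanSpace ℝ (Fin 2) →L[ℝ] EuclideanSpace ℝ (Fin 3)} (hL : Function.Injective L)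
    {w τ : EuclideanSpace ℝ (Fin 3)} (hw0 : w ≠ 0) (hw : ∀ v, inner ℝ w (L v) = 0)
    (hτ : inner ℝ w τ = 0) : ∃ e, L e = τ := by
  have hle : LinearMap.range (L : EuclideanSpace ℝ (Fin 2) →ₗ[ℝ] EuclideanSpace ℝ (Fin 3)) ≤
      (ℝ ∙ w)ᗮ := by
    rintro _ ⟨v, rfl⟩
    exact Submodule.mem_orthogonal_singleton_iff_inner_right.2 (hw v)
  have h2 : Module.finrank ℝ
      (LinearMap.range (L : EuclideanSpace ℝ (Fin 2) →ₗ[ℝ] EuclideanSpace ℝ (Fin 3))) = 2 := by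
    rw [LinearMap.finrank_range_of_inj hL]; simp
  have h3 : Module.finrank ℝ (ℝ ∙ w) + Module.finrank ℝ (ℝ ∙ w)ᗮ = 3 := by
    rw [Submodule.finrank_add_finrank_orthogonal]; simp
  rw [finrank_span_singleton hw0] at h3
  have heq := Submodule.eq_of_le_of_finrank_eq hle (by omega)
  have : τ ∈ (ℝ ∙ w)ᗮ := Submodule.mem_orthogonal_singleton_iff_inner_right.2 hτ
  rw [← heq] at this
  exact this

/-! ### The pointwise maximum principle -/

/-- If a curve moving by its curvature and a surface moving by its mean curvature minimise
`‖G s u - F s v‖ ^ 2 + δ * s` over a backward neighbourhood of a point where they do not meet, and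
the surface lies on one side of its tangent plane there, then `δ ≤ 0`. -/
theorem nonpos_of_isMin_dist_sq {G : ℝ → EuclideanSpace ℝ (Fin 1) → EuclideanSpace ℝ (Fin 3)}
    {F : ℝ → EuclideanSpace ℝ (Fin 2) → EuclideanSpace ℝ (Fin 3)}
    {u : EuclideanSpace ℝ (Fin 1)} {v : EuclideanSpace ℝ (Fin 2)} {t δ : ℝ}
    (hG : ContDiffAt ℝ 2 (G t) u) (hF : ContDiffAt ℝ 2 (F t) v)
    (hGt : DifferentiableAt ℝ (fun s => G s u) t) (hFt : DifferentiableAt ℝ (fun s => F s v) t)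
    (hGi : Function.Injective (fderiv ℝ (G t) u)) (hFi : Function.Injective (fderiv ℝ (F t) v))
    (hGe : normalPart (G t) u (deriv (fun s => G s u) t) = meanCurvatureVector (G t) u)
    (hFe : normalPart (F t) v (deriv (fun s => F s v) t) = meanCurvatureVector (F t) v)
    (hne : G t u - F t v ≠ 0)
    (hspace : ∀ᶠ u' in 𝓝 u, ∀ v', ‖G t u - F t v‖ ^ 2 ≤ ‖G t u' - F t v'‖ ^ 2)
    (htime : ∀ᶠ s in 𝓝[≤] t, ‖G t u - F t v‖ ^ 2 + δ * t ≤ ‖G s u - F s v‖ ^ 2 + δ * s)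
    (hconv : ∀ v', inner ℝ (G t u - F t v) (F t v' - F t v) ≤ 0) : δ ≤ 0 := by
  set w := G t u - F t v with hw
  -- first order conditions
  have hwG (a) : inner ℝ w (fderiv ℝ (G t) u a) = 0 := by
    have hd : HasFDerivAt (fun u' => ‖G t u' - F t v‖ ^ 2)
        (2 • (innerSL ℝ (G t u - F t v)).comp (fderiv ℝ (G t) u)) u :=
      ((hG.differentiableAt (by simp)).hasFDerivAt.sub_const (F t v)).norm_sq
    have hm : IsLocalMin (fun u' => ‖G t u' - F t v‖ ^ 2) u := hspace.mono fun u' h => h v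
    have h := congrArg (fun A => A a) (hm.hasFDerivAt_eq_zero hd)
    simpa [← hw] using h
  have hmaxF : IsLocalMax (fun v' => inner ℝ w (F t v')) v := by
    refine Filter.Eventually.of_forall fun v' => ?_
    have := hconv v'
    rw [inner_sub_right] at this
    simpa using this
  have hwF (a) : inner ℝ w (fderiv ℝ (F t) v a) = 0 := by
    have hd : HasFDerivAt (fun v' => inner ℝ w (F t v'))
        ((innerSL ℝ w).comp (fderiv ℝ (F t) v)) v :=
      (innerSL ℝ w).hasFDerivAt.comp v (hF.differentiableAt (by simp)).hasFDerivAt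
    have h := congrArg (fun A => A a) (hmaxF.hasFDerivAt_eq_zero hd)
    simpa using h
  -- the tangent direction of the curve, seen in the surface
  set b : EuclideanSpace ℝ (Fin 1) := EuclideanSpace.single 0 1 with hb
  have hb0 : b ≠ 0 := by simp [hb]
  have hτ : partialDeriv (G t) 0 u ≠ 0 := fun h => hb0 (hGi (by simpa [partialDeriv] using h))
  obtain ⟨e, he⟩ := exists_fderiv_eq_of_inner_eq_zero hFi hne hwF (hwG b)
  have he0 : e ≠ 0 := by
    rintro rfl
    rw [map_zero] at he
    exact hτ he.symm
  -- second order conditions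
  have hline {n : ℕ} (z a : EuclideanSpace ℝ (Fin n)) :
      Filter.Tendsto (fun s : ℝ => z + s • a) (𝓝 0) (𝓝 z) := by
    have : Continuous fun s : ℝ => z + s • a := by fun_prop
    simpa using this.tendsto 0
  have hB (a : EuclideanSpace ℝ (Fin 2)) :
      inner ℝ w (∑ j, a j • ∑ i, a i • partialDeriv (partialDeriv (F t) j) i v) ≤ 0 := by
    have h1 : ∀ᶠ s in 𝓝 (0 : ℝ), HasDerivAt (fun s : ℝ => -inner ℝ w (F t (v + s • a)))
        (-inner ℝ w (fderiv ℝ (F t) (v + s • a) a)) s := by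
      filter_upwards [hF.eventually_hasDerivAt_line a] with s hs
      exact ((innerSL ℝ w).hasFDerivAt.comp_hasDerivAt s hs).neg
    have h2 := ((innerSL ℝ w).hasFDerivAt.comp_hasDerivAt 0 (hF.hasDerivAt_fderiv_line a)).neg
    have h3 : IsLocalMin (fun s : ℝ => -inner ℝ w (F t (v + s • a))) 0 := by
      filter_upwards [(hline v a).eventually hmaxF] with s hs
      simpa using hs
    have := h3.second_deriv_nonneg h1 h2
    simpa using this
  -- Both points move with the same velocity, so the term with the squared relative velocity
  -- vanishes and only the accelerations paired with `w` remain.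
  have hS : 0 ≤ inner ℝ w (partialDeriv (partialDeriv (G t) 0) 0 u) -
      inner ℝ w (∑ j, e j • ∑ i, e i • partialDeriv (partialDeriv (F t) j) i v) := by
    have hG2 := hG.hasDerivAt_fderiv_line b
    have hF2 := hF.hasDerivAt_fderiv_line e
    have h1 : ∀ᶠ s in 𝓝 (0 : ℝ),
        HasDerivAt (fun s : ℝ => ‖G t (u + s • b) - F t (v + s • e)‖ ^ 2)
          (2 * inner ℝ (G t (u + s • b) - F t (v + s • e))
            (fderiv ℝ (G t) (u + s • b) b - fderiv ℝ (F t) (v + s • e) e)) s := by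
      filter_upwards [hG.eventually_hasDerivAt_line b, hF.eventually_hasDerivAt_line e]
        with s hs hs'
      exact (hs.sub hs').norm_sq
    have h2 := ((hG.eventually_hasDerivAt_line b).self_of_nhds.sub
      (hF.eventually_hasDerivAt_line e).self_of_nhds).inner ℝ (hG2.sub hF2) |>.const_mul 2
    have h3 : IsLocalMin (fun s : ℝ => ‖G t (u + s • b) - F t (v + s • e)‖ ^ 2) 0 := by
      filter_upwards [(hline u b).eventually hspace] with s hs
      simpa [← hw] using hs (v + s • e)
    have h := h3.second_deriv_nonneg h1 h2
    have hbe : fderiv ℝ (G t) u b - fderiv ℝ (F t) v e = 0 := by rw [he, sub_self]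
    have hw' : G t (u + (0 : ℝ) • b) - F t (v + (0 : ℝ) • e) = w := by simp [hw]
    have hbe' : fderiv ℝ (G t) (u + (0 : ℝ) • b) b - fderiv ℝ (F t) (v + (0 : ℝ) • e) e = 0 := by
      simpa using hbe
    simp only [Pi.sub_apply] at h
    rw [hw', hbe', inner_zero_left, add_zero, inner_sub_right] at h
    have hbb : ∑ j, b j • ∑ i, b i • partialDeriv (partialDeriv (G t) j) i u =
        partialDeriv (partialDeriv (G t) 0) 0 u := by simp [hb]
    rw [hbb] at h
    linarith
  have hT : 2 * inner ℝ w (deriv (fun s => G s u) t - deriv (fun s => F s v) t) + δ ≤ 0 := by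
    have hd : HasDerivAt (fun s => ‖G s u - F s v‖ ^ 2 + δ * s)
        (2 * inner ℝ w (deriv (fun s => G s u) t - deriv (fun s => F s v) t) + δ) t := by
      have h := (hasDerivAt_id t).const_mul δ
      rw [mul_one] at h
      exact (hGt.hasDerivAt.sub hFt.hasDerivAt).norm_sq.add h
    -- Minimality is known only backward in time, so the derivative is computed from left difference
    -- quotients, all nonpositive.
    refine le_of_tendsto (hd.tendsto_slope.mono_left
      (nhdsWithin_mono t fun s (hs : s ∈ Iio t) => (ne_of_lt hs : s ≠ t))) ?_
    filter_upwards [htime.filter_mono (nhdsWithin_mono t Iio_subset_Iic_self),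
      self_mem_nhdsWithin] with s hs hst
    rw [slope_def_field]
    exact div_nonpos_of_nonneg_of_nonpos (by linarith) (by linarith [mem_Iio.1 hst])
  have hGH := inner_normalPart_of_forall hwG (deriv (fun s => G s u) t)
  have hFH := inner_normalPart_of_forall hwF (deriv (fun s => F s v) t)
  rw [hGe] at hGH
  rw [hFe] at hFH
  rw [inner_sub_right, ← hGH, ← hFH] at hT
  have hk := inner_meanCurvatureVector_curve hwG hτ
  have hm := inner_meanCurvatureVector_mul_le hwF hFi he0 hB
  rw [he] at hm
  have hpos : 0 < ‖partialDeriv (G t) 0 u‖ ^ 2 := by positivity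
  have : inner ℝ w (meanCurvatureVector (F t) v) ≤ inner ℝ w (meanCurvatureVector (G t) u) := by
    refine le_of_mul_le_mul_right ?_ hpos
    change _ * ‖partialDeriv (G t) 0 u‖ ^ 2 ≤ _ at hm
    linarith
  linarith

/-! ### The flow read in charts -/

theorem isOpen_openTimeInterval (T : EReal) : IsOpen (openTimeInterval T) :=
  isOpen_Ioi.inter (isOpen_Iio.preimage continuous_coe_real_ereal)

theorem openTimeInterval_subset_timeInterval (T : EReal) :
    openTimeInterval T ⊆ timeInterval T := fun _ h => ⟨h.1.le, h.2⟩

namespace IsMeanCurvatureFlow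

variable {n : ℕ} {X : Type*} [TopologicalSpace X] [ChartedSpace (EuclideanSpace ℝ (Fin n)) X]
  {T : EReal} {F : ℝ → X → EuclideanSpace ℝ (Fin 3)}

theorem contMDiffAt (hF : IsMeanCurvatureFlow n T F) (x : X) {t : ℝ}
    (ht : t ∈ openTimeInterval T) :
    ContMDiffAt ((𝓡 n).prod 𝓘(ℝ, ℝ)) 𝓘(ℝ, EuclideanSpace ℝ (Fin 3)) ∞
      (fun p : X × ℝ => F p.2 p.1) (x, t) :=
  hF.smooth.contMDiffAt ((isOpen_univ.prod (isOpen_openTimeInterval T)).mem_nhds ⟨mem_univ _, ht⟩)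

theorem contMDiffAt_slice (hF : IsMeanCurvatureFlow n T F) (x : X) {t : ℝ}
    (ht : t ∈ openTimeInterval T) :
    ContMDiffAt (𝓡 n) 𝓘(ℝ, EuclideanSpace ℝ (Fin 3)) ∞ (F t) x :=
  ContMDiffAt.comp (f := fun y : X => (y, t)) x (hF.contMDiffAt x ht)
    (contMDiffAt_id.prodMk contMDiffAt_const)

theorem contDiffAt_chart [IsManifold (𝓡 n) ∞ X] (hF : IsMeanCurvatureFlow n T F) (x : X) {t : ℝ}
    (ht : t ∈ openTimeInterval T) :
    ContDiffAt ℝ ∞ (F t ∘ (chartAt (EuclideanSpace ℝ (Fin n)) x).symm)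
      (chartAt (EuclideanSpace ℝ (Fin n)) x x) := by
  set φ := chartAt (EuclideanSpace ℝ (Fin n)) x with hφ
  have h1 : ContMDiffAt (𝓡 n) (𝓡 n) ∞ φ.symm (φ x) :=
    contMDiffOn_chart_symm.contMDiffAt (φ.open_target.mem_nhds (mem_chart_target _ x))
  have h2 : ContMDiffAt (𝓡 n) 𝓘(ℝ, EuclideanSpace ℝ (Fin 3)) ∞ (F t) (φ.symm (φ x)) :=
    hF.contMDiffAt_slice _ ht
  exact (h2.comp (φ x) h1).contDiffAt

theorem differentiableAt_time (hF : IsMeanCurvatureFlow n T F) (x : X) {t : ℝ}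
    (ht : t ∈ openTimeInterval T) : DifferentiableAt ℝ (fun s => F s x) t := by
  have h : ContMDiffAt 𝓘(ℝ, ℝ) 𝓘(ℝ, EuclideanSpace ℝ (Fin 3)) ∞ (fun s => F s x) t :=
    ContMDiffAt.comp (f := fun s : ℝ => (x, s)) t (hF.contMDiffAt x ht)
      (contMDiffAt_const.prodMk contMDiffAt_id)
  exact h.contDiffAt.differentiableAt (by simp)

theorem injective_fderiv_chart (hF : IsMeanCurvatureFlow n T F) (x : X) {t : ℝ}
    (ht : t ∈ openTimeInterval T) :
    Function.Injective (fderiv ℝ (F t ∘ (chartAt (EuclideanSpace ℝ (Fin n)) x).symm)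
      (chartAt (EuclideanSpace ℝ (Fin n)) x x)) := by
  have h := hF.immersion t ht x
  rw [((hF.contMDiffAt_slice x ht).mdifferentiableAt (by simp)).mfderiv] at h
  simp only [mfld_simps, fderivWithin_univ] at h
  exact h

theorem evolution_chart (hF : IsMeanCurvatureFlow n T F) (x : X) {t : ℝ}
    (ht : t ∈ openTimeInterval T) :
    normalPart (F t ∘ (chartAt (EuclideanSpace ℝ (Fin n)) x).symm)
        (chartAt (EuclideanSpace ℝ (Fin n)) x x)
        (deriv (fun s => (F s ∘ (chartAt (EuclideanSpace ℝ (Fin n)) x).symm)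
          (chartAt (EuclideanSpace ℝ (Fin n)) x x)) t) =
      meanCurvatureVector (F t ∘ (chartAt (EuclideanSpace ℝ (Fin n)) x).symm)
        (chartAt (EuclideanSpace ℝ (Fin n)) x x) :=
  hF.evolution _ (chart_mem_atlas _ x) _ (mem_chart_target _ x) t ht

end IsMeanCurvatureFlow

/-! ### Distance to the convex sets -/

/-- The point of a closed convex set nearest to an outer point lies in the frontier and supports
the set. -/
theorem exists_mem_frontier_infDist_eq {A : Set (EuclideanSpace ℝ (Fin 3))} (hc : IsClosed A)
    (hconv : Convex ℝ A) (hne : A.Nonempty) {p : EuclideanSpace ℝ (Fin 3)} (hp : p ∉ A) :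
    ∃ q ∈ frontier A, Metric.infDist p A = ‖p - q‖ ∧ ∀ z ∈ A, inner ℝ (p - q) (z - q) ≤ 0 := by
  obtain ⟨q, hq, hpq⟩ := hc.exists_infDist_eq_dist hne p
  rw [dist_eq_norm] at hpq
  have hsupp : ∀ z ∈ A, inner ℝ (p - q) (z - q) ≤ 0 := by
    rw [← norm_eq_iInf_iff_real_inner_le_zero hconv hq, ← hpq, Metric.infDist_eq_iInf]
    simp only [dist_eq_norm]
  refine ⟨q, ?_, hpq, hsupp⟩
  rw [hc.frontier_eq]
  -- If `q` were interior, a short step from `q` towards `p` would stay in `A` and violate the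
  -- supporting inequality.
  refine ⟨hq, fun hi => ?_⟩
  have hpq0 : p - q ≠ 0 := sub_ne_zero.2 fun h => hp (h ▸ hq)
  have htend : Filter.Tendsto (fun s : ℝ => q + s • (p - q)) (𝓝[>] 0) (𝓝 q) := by
    have : Continuous fun s : ℝ => q + s • (p - q) := by fun_prop
    simpa using (this.tendsto 0).mono_left nhdsWithin_le_nhds
  obtain ⟨s, hs, hs0⟩ := ((htend.eventually (mem_interior_iff_mem_nhds.1 hi)).and
    self_mem_nhdsWithin).exists
  have h := hsupp _ hs
  rw [add_sub_cancel_left, inner_smul_right, real_inner_self_eq_norm_sq] at h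
  have : 0 < s * ‖p - q‖ ^ 2 := mul_pos hs0 (by positivity)
  linarith

section

variable {C : Type*} [TopologicalSpace C] [ChartedSpace (EuclideanSpace ℝ (Fin 1)) C]
  [IsManifold (𝓡 1) ∞ C] {M : Type*} [TopologicalSpace M]
  [ChartedSpace (EuclideanSpace ℝ (Fin 2)) M] [IsManifold (𝓡 2) ∞ M]
  {T : EReal} {γ : ℝ → C → EuclideanSpace ℝ (Fin 3)} {F : ℝ → M → EuclideanSpace ℝ (Fin 3)}
  {K : ℝ → Set (EuclideanSpace ℝ (Fin 3))}

/-- The maximum principle for the squared distance of a curve shortening flow to a convex mean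
curvature flow. -/
theorem IsCurveShorteningFlow.nonpos_of_isMin_infDist_sq (hγ : IsCurveShorteningFlow T γ)
    (hF : IsConvexMeanCurvatureFlow T F K) {x : C} {τ : timeInterval T} (hτ : 0 < (τ : ℝ))
    (hout : γ τ x ∉ K τ) {δ : ℝ}
    (hmin : ∀ᶠ p : C × timeInterval T in 𝓝 (x, τ), (p.2 : ℝ) ≤ τ →
      Metric.infDist (γ τ x) (K τ) ^ 2 + δ * τ ≤
        Metric.infDist (γ p.2 p.1) (K p.2) ^ 2 + δ * p.2) : δ ≤ 0 := by
  have hτo : (τ : ℝ) ∈ openTimeInterval T := ⟨hτ, τ.2.2⟩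
  have hK (t : ℝ) (ht : t ∈ timeInterval T) (y : M) : F t y ∈ K t :=
    (hF.isClosed t ht).frontier_subset (hF.range_eq t ht ▸ mem_range_self y)
  obtain ⟨q, hq, hdist, hsupp⟩ := exists_mem_frontier_infDist_eq (hF.isClosed τ τ.2)
    (hF.convex τ τ.2) ((hF.interior_nonempty τ τ.2).mono interior_subset) hout
  rw [← hF.range_eq τ τ.2] at hq
  obtain ⟨y, rfl⟩ := hq
  -- Every surface point bounds the distance from above, with equality at `y` at time `τ`. The
  -- minimum thus passes to the smooth function `‖γ - F‖ ^ 2`, and no differentiability of `infDist`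
  -- is needed.
  have hle (t : ℝ) (ht : t ∈ timeInterval T) (a : EuclideanSpace ℝ (Fin 3)) (y' : M) :
      Metric.infDist a (K t) ^ 2 ≤ ‖a - F t y'‖ ^ 2 := by
    rw [← dist_eq_norm]
    exact pow_le_pow_left₀ Metric.infDist_nonneg (Metric.infDist_le_dist_of_mem (hK t ht y')) 2
  rw [hdist] at hmin
  set φ := chartAt (EuclideanSpace ℝ (Fin 1)) x with hφ
  set ψ := chartAt (EuclideanSpace ℝ (Fin 2)) y with hψ
  have hφx : φ.symm (φ x) = x := φ.left_inv (mem_chart_source _ x)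
  have hψy : ψ.symm (ψ y) = y := ψ.left_inv (mem_chart_source _ y)
  refine nonpos_of_isMin_dist_sq (G := fun s => γ s ∘ φ.symm) (F := fun s => F s ∘ ψ.symm)
    (u := φ x) (v := ψ y) (t := τ)
    (contDiffAt_infty.1 (hγ.contDiffAt_chart x hτo) 2)
    (contDiffAt_infty.1 (hF.flow.contDiffAt_chart y hτo) 2)
    (hγ.differentiableAt_time _ hτo) (hF.flow.differentiableAt_time _ hτo)
    (hγ.injective_fderiv_chart x hτo) (hF.flow.injective_fderiv_chart y hτo)
    (hγ.evolution_chart x hτo) (hF.flow.evolution_chart y hτo) ?_ ?_ ?_ ?_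
  · simp only [Function.comp_apply, hφx, hψy]
    exact sub_ne_zero.2 fun h => hout (h ▸ hK τ τ.2 y)
  · have hc : Filter.Tendsto (fun u' => (φ.symm u', τ)) (𝓝 (φ x)) (𝓝 (x, τ)) := by
      have h : ContinuousAt φ.symm (φ x) := φ.continuousAt_symm (mem_chart_target _ x)
      rw [ContinuousAt, hφx] at h
      exact h.prodMk_nhds tendsto_const_nhds
    filter_upwards [hc.eventually hmin] with u' hu' v'
    simp only [Function.comp_apply, hφx, hψy]
    have h1 := hu' le_rfl
    have h2 := hle τ τ.2 (γ τ (φ.symm u')) (ψ.symm v')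
    linarith
  · have hc : Filter.Tendsto (fun s : timeInterval T => (x, s)) (𝓝 τ) (𝓝 (x, τ)) :=
      tendsto_const_nhds.prodMk_nhds Filter.tendsto_id
    have hI : ∀ᶠ s : ℝ in 𝓝 (τ : ℝ), s ∈ timeInterval T :=
      Filter.mem_of_superset ((isOpen_openTimeInterval T).mem_nhds hτo)
        (openTimeInterval_subset_timeInterval T)
    have hev : ∀ᶠ s : ℝ in 𝓝 (τ : ℝ), s ≤ τ → ‖γ τ x - F τ y‖ ^ 2 + δ * τ ≤
        Metric.infDist (γ s x) (K s) ^ 2 + δ * s := by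
      rw [← map_nhds_subtype_coe_eq_nhds (x := (τ : ℝ)) τ.2 hI, Filter.eventually_map]
      exact hc.eventually hmin
    filter_upwards [hev.filter_mono nhdsWithin_le_nhds, hI.filter_mono nhdsWithin_le_nhds,
      self_mem_nhdsWithin] with s hs hsI hsτ
    simp only [Function.comp_apply, hφx, hψy]
    have h1 := hs hsτ
    have h2 := hle s hsI (γ s x) y
    linarith
  · intro v'
    simp only [Function.comp_apply, hφx, hψy]
    exact hsupp _ (hK τ τ.2 _)

end

/-- Upper semicontinuity: by convexity the interior is dense in `K i₀`, so an almost nearest point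
can be taken interior, and it stays in `K i` for nearby `i`. Lower semicontinuity: a compact ball
missing `K i₀` misses all nearby `K i`. -/
theorem continuous_infDist_of_isOpen {ι : Type*} [TopologicalSpace ι]
    {K : ι → Set (EuclideanSpace ℝ (Fin 3))} (hconv : ∀ i, Convex ℝ (K i))
    (hne : ∀ i, (interior (K i)).Nonempty)
    (hin : IsOpen {p : EuclideanSpace ℝ (Fin 3) × ι | p.1 ∈ interior (K p.2)})
    (hout : IsOpen {p : EuclideanSpace ℝ (Fin 3) × ι | p.1 ∉ K p.2}) :
    Continuous fun p : EuclideanSpace ℝ (Fin 3) × ι => Metric.infDist p.1 (K p.2) := by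
  refine continuous_iff_continuousAt.2 fun ⟨p₀, i₀⟩ => Metric.tendsto_nhds.2 fun ε hε => ?_
  set d := Metric.infDist p₀ (K i₀) with hd
  have hp : ∀ᶠ p in 𝓝 p₀, dist p p₀ < ε / 2 := Metric.ball_mem_nhds p₀ (by positivity)
  have hupper : ∀ᶠ i in 𝓝 i₀, Metric.infDist p₀ (K i) < d + ε / 2 := by
    have h : Metric.infDist p₀ (interior (K i₀)) < d + ε / 2 := by
      rw [← Metric.infDist_closure,
        (hconv i₀).closure_interior_eq_closure_of_nonempty_interior (hne i₀),
        Metric.infDist_closure]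
      linarith
    obtain ⟨q, hq, hqd⟩ := (Metric.infDist_lt_iff (hne i₀)).1 h
    have hc : Continuous fun i : ι => (q, i) := by fun_prop
    filter_upwards [(hin.preimage hc).mem_nhds hq] with i hi
    exact (Metric.infDist_le_dist_of_mem (interior_subset hi)).trans_lt hqd
  have hlower : ∀ᶠ i in 𝓝 i₀, d - ε / 2 ≤ Metric.infDist p₀ (K i) := by
    have h : ∀ᶠ i in 𝓝 i₀, ∀ q ∈ Metric.closedBall p₀ (d - ε / 2), q ∉ K i := by
      refine (isCompact_closedBall p₀ (d - ε / 2)).eventually_forall_of_forall_eventually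
        fun q hq => ?_
      have hq' : q ∉ K i₀ := fun hqK => by
        have h1 := Metric.infDist_le_dist_of_mem (x := p₀) hqK
        rw [Metric.mem_closedBall, dist_comm] at hq
        linarith
      exact (hout.preimage continuous_swap).mem_nhds (x := (i₀, q)) hq'
    filter_upwards [h] with i hi
    refine (Metric.le_infDist ((hne i).mono interior_subset)).2 fun q hq => ?_
    by_contra! hlt
    exact hi q (by rw [Metric.mem_closedBall, dist_comm]; exact hlt.le) hq
  rw [nhds_prod_eq]
  filter_upwards [hp.prod_mk (hupper.and hlower)] with ⟨p, i⟩ ⟨h1, h2, h3⟩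
  dsimp only at h1 h2 h3 ⊢
  have h4 := Metric.infDist_le_infDist_add_dist (s := K i) (x := p) (y := p₀)
  have h5 := Metric.infDist_le_infDist_add_dist (s := K i) (x := p₀) (y := p)
  rw [dist_comm p₀ p] at h5
  rw [Real.dist_eq, abs_lt]
  constructor <;> linarith

/-! ### Topology of the time interval -/

theorem image_coe_setOf_le {T : EReal} (t : timeInterval T) :
    (Subtype.val '' {s : timeInterval T | s ≤ t} : Set ℝ) = Icc 0 (t : ℝ) := by
  ext s
  constructor
  · rintro ⟨s, hs, rfl⟩
    exact ⟨s.2.1, hs⟩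
  · rintro ⟨h0, hs⟩
    exact ⟨⟨s, h0, (EReal.coe_le_coe_iff.2 hs).trans_lt t.2.2⟩, hs, rfl⟩

theorem isCompact_setOf_le {T : EReal} (t : timeInterval T) :
    IsCompact {s : timeInterval T | s ≤ t} := by
  rw [Subtype.isCompact_iff, image_coe_setOf_le]
  exact isCompact_Icc

theorem isPreconnected_setOf_le {T : EReal} (t : timeInterval T) :
    IsPreconnected {s : timeInterval T | s ≤ t} := by
  rw [← Topology.IsInducing.subtypeVal.isPreconnected_image, image_coe_setOf_le]
  exact isPreconnected_Icc

theorem exists_lt_of_mem_nhds {T : EReal} {t : timeInterval T} (ht : 0 < (t : ℝ))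
    {U : Set (timeInterval T)} (hU : U ∈ 𝓝 t) : ∃ s ∈ U, s < t := by
  obtain ⟨ε, hε, hball⟩ := Metric.mem_nhds_iff.1 hU
  have h1 : max (t - ε / 2) 0 < (t : ℝ) := max_lt (by linarith) ht
  refine ⟨⟨max (t - ε / 2) 0, le_max_right _ _, (EReal.coe_lt_coe_iff.2 h1).trans t.2.2⟩,
    hball ?_, h1⟩
  rw [Metric.mem_ball, Subtype.dist_eq, Real.dist_eq, abs_lt]
  constructor <;> linarith [le_max_left (t - ε / 2) (0 : ℝ)]

/-! ### The first contact argument -/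

set_option maxHeartbeats 1000000 in
theorem mainTheorem3
    {C : Type*} [TopologicalSpace C] [T2Space C] [SecondCountableTopology C]
    [ChartedSpace (EuclideanSpace ℝ (Fin 1)) C] [IsManifold (𝓡 1) ∞ C]
    {M : Type*} [TopologicalSpace M] [T2Space M] [SecondCountableTopology M]
    [ChartedSpace (EuclideanSpace ℝ (Fin 2)) M] [IsManifold (𝓡 2) ∞ M]
    (T : EReal)
    (γ : ℝ → C → EuclideanSpace ℝ (Fin 3)) (hγ : IsCurveShorteningFlow T γ)
    (F : ℝ → M → EuclideanSpace ℝ (Fin 3)) (K : ℝ → Set (EuclideanSpace ℝ (Fin 3)))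
    (hF : IsConvexMeanCurvatureFlow T F K)
    (hinit : Disjoint (range (γ 0)) (K 0))
    (hbdd : Bornology.IsBounded (⋃ t ∈ timeInterval T, range (γ t) ∩ range (F t))) :
    ∀ t ∈ timeInterval T, Disjoint (range (γ t)) (range (F t)) := by
  intro t ht
  rw [Set.disjoint_left]
  rintro q ⟨x, hx⟩ hqF
  obtain ⟨R, hR⟩ := hbdd.subset_closedBall 0
  let P : C × timeInterval T → EuclideanSpace ℝ (Fin 3) × timeInterval T :=
    fun p => (γ p.2 p.1, p.2)
  have hP : IsProperMap P := hγ.proper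
  let D : C × timeInterval T → ℝ := fun p => Metric.infDist (γ p.2 p.1) (K p.2)
  have hD : Continuous D :=
    (continuous_infDist_of_isOpen (K := fun s : timeInterval T => K s)
      (fun s => hF.convex s s.2) (fun s => hF.interior_nonempty s s.2)
      hF.isOpen_inside hF.isOpen_outside).comp hP.continuous
  have hγn : Continuous fun p : C × timeInterval T => ‖γ p.2 p.1‖ :=
    (continuous_fst.comp hP.continuous).norm
  have hIn : IsOpen {p : C × timeInterval T | γ p.2 p.1 ∈ interior (K p.2)} :=
    hF.isOpen_inside.preimage hP.continuous
  have hOut : IsOpen {p : C × timeInterval T | γ p.2 p.1 ∉ K p.2} :=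
    hF.isOpen_outside.preimage hP.continuous
  have hfront (s : timeInterval T) : range (F s) = K s \ interior (K s) := by
    rw [hF.range_eq s s.2, (hF.isClosed s s.2).frontier_eq]
  have hcompact (r : ℝ) (s : timeInterval T) :
      IsCompact {p : C × timeInterval T | ‖γ p.2 p.1‖ ≤ r ∧ p.2 ≤ s} := by
    have h := hP.isCompact_preimage
      ((isCompact_closedBall (0 : EuclideanSpace ℝ (Fin 3)) r).prod (isCompact_setOf_le s))
    convert h using 1
    ext p
    simp [P]
  have hpos (p : C × timeInterval T) (h : γ p.2 p.1 ∉ K p.2) : 0 < D p :=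
    ((hF.isClosed p.2 p.2.2).notMem_iff_infDist_pos
      ((hF.interior_nonempty p.2 p.2.2).mono interior_subset)).1 h
  -- `N` is the space-time set of contacts; its complement is the union of the open outside and
  -- inside.
  let N : Set (C × timeInterval T) := {p | γ p.2 p.1 ∈ K p.2 ∧ γ p.2 p.1 ∉ interior (K p.2)}
  have hN : IsClosed N := by
    have : N = ({p : C × timeInterval T | γ p.2 p.1 ∉ K p.2} ∪
        {p : C × timeInterval T | γ p.2 p.1 ∈ interior (K p.2)})ᶜ := by
      ext p; simp [N]
    rw [this]
    exact (hOut.union hIn).isClosed_compl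
  have hNR (p) (hp : p ∈ N) : ‖γ p.2 p.1‖ ≤ R := by
    have h : γ p.2 p.1 ∈ Metric.closedBall (0 : EuclideanSpace ℝ (Fin 3)) R :=
      hR (mem_iUnion₂.2 ⟨p.2, p.2.2, mem_range_self p.1, by rw [hfront]; exact hp⟩)
    simpa using h
  -- the first contact
  have hxN : (x, ⟨t, ht⟩) ∈ N := by
    have h := hfront ⟨t, ht⟩
    rw [← hx] at hqF
    exact (h ▸ hqF :)
  obtain ⟨⟨x₀, τ₀⟩, ⟨hp₀N, -, hp₀t⟩, hfirst'⟩ := (hcompact R ⟨t, ht⟩).inter_left hN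
    |>.exists_isMinOn ⟨_, hxN, hNR _ hxN, le_rfl⟩ (f := fun p => p.2)
      continuous_snd.continuousOn
  have hfirst (p) (hp : p ∈ N) : τ₀ ≤ p.2 := by
    by_cases h : p.2 ≤ ⟨t, ht⟩
    · exact hfirst' ⟨hp, hNR p hp, h⟩
    · exact hp₀t.trans (not_le.1 h).le
  let o : timeInterval T := ⟨0, le_rfl, (EReal.coe_le_coe_iff.2 ht.1).trans_lt ht.2⟩
  have hinit' (y : C) : γ o y ∉ K o := Set.disjoint_left.1 hinit (mem_range_self y)
  have hτ₀ : 0 < (τ₀ : ℝ) := by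
    refine τ₀.2.1.lt_of_ne fun h => hinit' x₀ ?_
    have : τ₀ = o := Subtype.ext h.symm
    rw [← this]
    exact hp₀N.1
  -- before the first contact, the curve is outside
  have hbefore (y : C) (s : timeInterval T) (hs : s < τ₀) : γ s y ∉ K s := by
    have hy : Continuous fun s : timeInterval T => (y, s) := by fun_prop
    -- Up to time `s` there is no contact, so these times are covered by the disjoint open sets
    -- "outside" and "inside"; at time `0` the point is outside.
    refine (isPreconnected_setOf_le s).subset_left_of_subset_union (hOut.preimage hy)
      (hIn.preimage hy) ?_ ?_ ⟨o, s.2.1, hinit' y⟩ (le_refl s)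
    · exact Set.disjoint_left.2 fun r h1 h2 => h1 (interior_subset h2)
    · intro r hr
      by_contra h
      simp only [mem_union, mem_preimage, mem_ofPred_eq, not_or, not_not] at h
      exact absurd (hfirst (y, r) h) (not_le.2 (lt_of_le_of_lt hr hs))
  have hnotIn (y : C) : γ τ₀ y ∉ interior (K τ₀) := by
    intro h
    have hy : Continuous fun s : timeInterval T => (y, s) := by fun_prop
    obtain ⟨s, hs, hlt⟩ := exists_lt_of_mem_nhds hτ₀ ((hIn.preimage hy).mem_nhds h)
    exact hbefore y s hlt (interior_subset hs)
  -- a positive lower bound on the parabolic boundary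
  let B : Set (C × timeInterval T) :=
    {p | ‖γ p.2 p.1‖ ≤ R + 1 ∧ p.2 ≤ τ₀} ∩ {p | (p.2 : ℝ) = 0 ∨ ‖γ p.2 p.1‖ = R + 1}
  have hB : IsCompact B := by
    refine (hcompact (R + 1) τ₀).inter_right (IsClosed.union ?_ ?_)
    · exact isClosed_eq (continuous_subtype_val.comp continuous_snd) continuous_const
    · exact isClosed_eq hγn continuous_const
  have hBpos (p) (hp : p ∈ B) : 0 < D p ^ 2 := by
    refine pow_pos (hpos p ?_) 2
    obtain ⟨⟨-, hle⟩, hp⟩ := hp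
    rcases hle.lt_or_eq with hlt | heq
    · exact hbefore _ _ hlt
    · rcases hp with hp | hp
      · rw [heq] at hp
        exact absurd hp hτ₀.ne'
      -- This case is needed at time `τ₀` itself: contacts stay in the ball of radius `R`, hence off
      -- the sphere of radius `R + 1`.
      · intro hK
        have : p ∈ N := ⟨hK, by rw [heq]; exact hnotIn _⟩
        linarith [hNR p this]
  obtain ⟨ε, hε, hBε⟩ := hB.exists_forall_le' (hD.pow 2).continuousOn hBpos
  -- The budget `ε` is split in two: one half for `δ * τ₀`, the other for `D ^ 2` at time `s`.
  obtain ⟨δ, hδ, hδτ⟩ : ∃ δ : ℝ, 0 < δ ∧ δ * τ₀ < ε / 2 := by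
    refine ⟨ε / (2 * (τ₀ + 1)), by positivity, ?_⟩
    rw [div_mul_eq_mul_div, div_lt_div_iff₀ (by positivity) (by positivity)]
    nlinarith
  -- a time shortly before the first contact
  obtain ⟨s, ⟨hsD, hsR⟩, hsτ⟩ : ∃ s ∈ {s : timeInterval T | D (x₀, s) ^ 2 < ε / 2 ∧
      ‖γ s x₀‖ < R + 1}, s < τ₀ := by
    have hy : Continuous fun s : timeInterval T => (x₀, s) := by fun_prop
    refine exists_lt_of_mem_nhds hτ₀ (IsOpen.mem_nhds (IsOpen.inter ?_ ?_) ⟨?_, ?_⟩)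
    · exact isOpen_lt ((hD.pow 2).comp hy) continuous_const
    · exact isOpen_lt (hγn.comp hy) continuous_const
    · have : D (x₀, τ₀) = 0 := Metric.infDist_zero_of_mem hp₀N.1
      change D (x₀, τ₀) ^ 2 < ε / 2
      rw [this]
      linarith
    · have := hNR _ hp₀N
      exact lt_of_le_of_lt this (by linarith)
  -- an interior minimum
  have hτc : Continuous fun p : C × timeInterval T => (p.2 : ℝ) :=
    continuous_subtype_val.comp continuous_snd
  -- Stopping at `s < τ₀` keeps the curve strictly outside, so `w ≠ 0` at the minimum. The minimum
  -- may occur at the final time `s`, which is why only backward neighbourhoods are used.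
  obtain ⟨⟨x₁, τ₁⟩, ⟨hR₁, hτ₁⟩, hmin⟩ := (hcompact (R + 1) s).exists_isMinOn
    ⟨(x₀, s), hsR.le, le_rfl⟩ (f := fun p => D p ^ 2 + δ * p.2)
    ((hD.pow 2).add (hτc.const_mul δ)).continuousOn
  have hτ₁' : τ₁ ≤ s := hτ₁
  have hlt : D (x₁, τ₁) ^ 2 + δ * τ₁ < ε := by
    have h1 : D (x₁, τ₁) ^ 2 + δ * τ₁ ≤ D (x₀, s) ^ 2 + δ * s := hmin ⟨hsR.le, le_refl s⟩
    have h2 : δ * s ≤ δ * τ₀ := mul_le_mul_of_nonneg_left hsτ.le hδ.le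
    linarith
  have hnB : (x₁, τ₁) ∉ B := fun h => by
    have h1 : ε ≤ D (x₁, τ₁) ^ 2 := hBε _ h
    have h2 : 0 ≤ δ * (τ₁ : ℝ) := mul_nonneg hδ.le τ₁.2.1
    linarith
  have hnB' : ¬((τ₁ : ℝ) = 0 ∨ ‖γ τ₁ x₁‖ = R + 1) := fun h =>
    hnB ⟨⟨hR₁, hτ₁'.trans hsτ.le⟩, h⟩
  rw [not_or] at hnB'
  refine absurd (hγ.nonpos_of_isMin_infDist_sq hF (x := x₁) (τ := τ₁)
    (τ₁.2.1.lt_of_ne' hnB'.1) (hbefore _ _ (hτ₁'.trans_lt hsτ)) (δ := δ) ?_) hδ.not_ge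
  have hev : ∀ᶠ p : C × timeInterval T in 𝓝 (x₁, τ₁), ‖γ p.2 p.1‖ < R + 1 :=
    (isOpen_lt hγn continuous_const).mem_nhds (lt_of_le_of_ne hR₁ hnB'.2)
  filter_upwards [hev] with p hp hpτ
  exact hmin ⟨hp.le, le_trans (show p.2 ≤ τ₁ from hpτ) hτ₁'⟩
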